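/- Let $G$ be a finite abelian group, let $\mathrm{Aut}(G)$ be its automorphism group, and suppose $|\mathrm{Aut}(G)|/|G| = a/b$, where $a$ and $b$ are coprime integers with $b \neq 0$. Then $b$ is squarefree (that is, $b$ is not divisible by the square of any prime). Consequently, the question "Is it true that for every positive rational number $r$ there exists a finite abelian group $G$ such that $|\mathrm{Aut}(G)|/|G| = r$?" has a negative answer: there is a positive rational number $r$ such that $|\mathrm{Aut}(G)|/|G| \neq r$ for every finite abelian group $G$. -/

import Mathlib

universe u

/-!
The idea is to exhibit a subgroup of `MulAut G` whose order is nearly `|G|`. Let `g` be an element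
whose order `m` is the exponent of `G`, and let `C` be the cyclic group it generates. Since `C`
contains enough `m`-th roots of unity for the duality theory of groups of exponent dividing `m`,
two things hold:

* there are exactly `|G ⧸ C|` homomorphisms `f : G ⧸ C →* C`, and each gives a shear
  `x ↦ x * f x` of `G`, which fixes `C` pointwise;
* the identity of `C` extends to a retraction `r : G →* C`, so every automorphism `β` of `C` extends
  to the automorphism `x ↦ x * (r x)⁻¹ * β (r x)` of `G`.

The second kind normalizes the first, and together they embed a semidirect product of order
`|G ⧸ C| * φ m` in `MulAut G` (`card_quotient_mul_totient_dvd_card_mulAut`). As `|G| = |G ⧸ C| * m`,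
the ratio `|MulAut G| / |G|` is an integral multiple of `φ m / m = ∏ (p - 1) / p`, the product
over the primes `p ∣ m`. Its reduced denominator thus divides the radical of `m`, which is
squarefree. In particular the value `1 / 4` is never taken.
-/

section Automorphisms

variable {G : Type*} [CommGroup G] {C : Subgroup G}

/-- The shear `x ↦ x * f x` of `G` given by a homomorphism `f : G ⧸ C →* C`. As `f` vanishes on `C`,
composing shears corresponds to multiplying homomorphisms. -/
def shear (C : Subgroup G) : (G ⧸ C →* C) →* MulAut G where
  toFun f :=
    { toFun x := x * f x
      invFun x := x * (f x)⁻¹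
      left_inv x := by simp
      right_inv x := by simp
      map_mul' x y := by simp [mul_mul_mul_comm] }
  map_one' := by ext; simp
  map_mul' f f' := by
    ext x
    simp [mul_comm, mul_left_comm]

@[simp]
lemma shear_apply (f : G ⧸ C →* C) (x : G) : shear C f x = x * f x := rfl

lemma shear_apply_of_mem (f : G ⧸ C →* C) {x : G} (hx : x ∈ C) : shear C f x = x := by
  simp [(QuotientGroup.eq_one_iff x).2 hx]

lemma shear_injective : Function.Injective (shear C) := by
  intro f f' h
  ext x
  simpa using DFunLike.congr_fun h x

/-- The extension of automorphisms of `C` to `G` given by a retraction `r : G →* C`: the extended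
automorphism acts trivially on the complement `r.ker` of `C`. -/
def extendAut (r : G →* C) (hr : ∀ c : C, r c = c) : MulAut C →* MulAut G where
  toFun β :=
    { toFun x := x * (r x)⁻¹ * β (r x)
      invFun x := x * (r x)⁻¹ * β⁻¹ (r x)
      left_inv x := by simp [hr]
      right_inv x := by simp [hr]
      map_mul' x y := by simp [mul_assoc, mul_comm, mul_left_comm] }
  map_one' := by ext; simp
  map_mul' β β' := by
    ext x
    simp [hr]

lemma extendAut_apply (r : G →* C) (hr : ∀ c : C, r c = c) (β : MulAut C) (x : G) :
    extendAut r hr β x = x * (r x)⁻¹ * β (r x) := rfl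

@[simp]
lemma extendAut_apply_coe (r : G →* C) (hr : ∀ c : C, r c = c) (β : MulAut C) (c : C) :
    extendAut r hr β c = β c := by
  simp [extendAut_apply, hr]

@[simp]
lemma mk_extendAut_apply (r : G →* C) (hr : ∀ c : C, r c = c) (β : MulAut C) (x : G) :
    (extendAut r hr β x : G ⧸ C) = x := by
  rw [extendAut_apply, QuotientGroup.eq, ← inv_mem_iff]
  simp [mul_assoc, C.mul_mem]

/-- Automorphisms of `C` act on `G ⧸ C →* C` by composition on the left. -/
def postcompAut (C : Subgroup G) : MulAut C →* MulAut (G ⧸ C →* C) where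
  toFun β := β.monoidHomCongrRight
  map_one' := rfl
  map_mul' _ _ := rfl

@[simp]
lemma postcompAut_apply (β : MulAut C) (f : G ⧸ C →* C) (x : G ⧸ C) :
    postcompAut C β f x = β (f x) := rfl

lemma shear_comp_postcompAut (r : G →* C) (hr : ∀ c : C, r c = c) (β : MulAut C) :
    (shear C).comp (postcompAut C β).toMonoidHom =
      (MulAut.conj (extendAut r hr β)).toMonoidHom.comp (shear C) := by
  ext f x
  obtain ⟨y, rfl⟩ := (extendAut r hr β).surjective x
  simp

/-- Shears and extended automorphisms together form a semidirect product inside `MulAut G`. -/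
def semidirectToMulAut (r : G →* C) (hr : ∀ c : C, r c = c) :
    (G ⧸ C →* C) ⋊[postcompAut C] MulAut C →* MulAut G :=
  SemidirectProduct.lift (shear C) (extendAut r hr) (shear_comp_postcompAut r hr)

lemma semidirectToMulAut_injective (r : G →* C) (hr : ∀ c : C, r c = c) :
    Function.Injective (semidirectToMulAut r hr) := by
  rw [injective_iff_map_eq_one]
  rintro ⟨f, β⟩ h
  replace h : shear C f * extendAut r hr β = 1 := h
  -- On `C` the shear is trivial, so the product restricts to `β`.
  obtain rfl : β = 1 := by
    ext c
    have := DFunLike.congr_fun h (c : G)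
    rwa [MulAut.mul_apply, extendAut_apply_coe, shear_apply_of_mem f (β c).2] at this
  rw [map_one, mul_one] at h
  obtain rfl : f = 1 := shear_injective (h.trans (map_one _).symm)
  rfl

end Automorphisms

section Duality

/-- A cyclic group is a suitable target for the duality of groups of exponent equal to its order. -/
lemma IsCyclic.hasEnoughRootsOfUnity (C : Type*) [CommGroup C] [IsCyclic C] :
    HasEnoughRootsOfUnity C (Nat.card C) where
  prim := by
    obtain ⟨g, hg⟩ := IsCyclic.exists_generator (α := C)
    exact ⟨g, orderOf_eq_card_of_forall_mem_zpowers hg ▸ IsPrimitiveRoot.orderOf g⟩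
  cyc := by
    have : IsCyclic Cˣ := isCyclic_of_surjective _ (toUnits (G := C)).surjective
    infer_instance

variable {G : Type*} [CommGroup G] (C : Subgroup G) [IsCyclic C]

lemma hasEnoughRootsOfUnity_exponent (hC : Nat.card C = Monoid.exponent G) :
    HasEnoughRootsOfUnity C (Monoid.exponent G) :=
  hC ▸ IsCyclic.hasEnoughRootsOfUnity C

variable [Finite G]

/-- A cyclic subgroup of order the exponent is a retract. -/
lemma exists_retraction (hC : Nat.card C = Monoid.exponent G) :
    ∃ r : G →* C, ∀ c : C, r c = c := by
  have := hasEnoughRootsOfUnity_exponent C hC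
  obtain ⟨χ, hχ⟩ := MonoidHom.domRestrict_surjective C C (toUnits (G := C)).toMonoidHom
  refine ⟨(toUnits (G := C)).symm.toMonoidHom.comp χ, fun c ↦ ?_⟩
  have : χ c = toUnits c := DFunLike.congr_fun hχ c
  simp [this]

lemma card_quotient_monoidHom (hC : Nat.card C = Monoid.exponent G) :
    Nat.card (G ⧸ C →* C) = Nat.card (G ⧸ C) := by
  have := hasEnoughRootsOfUnity_exponent C hC
  have : HasEnoughRootsOfUnity C (Monoid.exponent (G ⧸ C)) :=
    .of_dvd C (Group.exponent_quotient_dvd C)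
  rw [← CommGroup.card_monoidHom_of_hasEnoughRootsOfUnity (G ⧸ C) C]
  exact Nat.card_congr (toUnits (G := C)).monoidHomCongrRight.toEquiv

/-- The lower bound on the automorphism group, in divisibility form. -/
theorem card_quotient_mul_totient_dvd_card_mulAut (hC : Nat.card C = Monoid.exponent G) :
    Nat.card (G ⧸ C) * Nat.totient (Nat.card C) ∣ Nat.card (MulAut G) := by
  obtain ⟨r, hr⟩ := exists_retraction C hC
  rw [← card_quotient_monoidHom C hC, ← IsCyclic.card_mulAut C, ← SemidirectProduct.card]
  exact Subgroup.card_dvd_of_injective _ (semidirectToMulAut_injective r hr)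

end Duality

section Denominator

open UniqueFactorizationMonoid in
/-- Clearing denominators in `a / b = k * φ m / m` and using Euler's product for `φ m`. -/
lemma dvd_radical_of_mul_eq_mul_totient {a b k : ℤ} {m : ℕ} (hm : m ≠ 0) (hab : IsCoprime a b)
    (h : a * m = b * (k * Nat.totient m)) : b ∣ (radical m : ℕ) := by
  have euler : (Nat.totient m * radical m : ℤ) = m * (∏ p ∈ m.primeFactors, (p - 1) : ℕ) := by
    rw [Nat.radical_eq_prod_primeFactors]
    exact_mod_cast Nat.totient_mul_prod_primeFactors m
  refine hab.symm.dvd_of_dvd_mul_left ⟨k * (∏ p ∈ m.primeFactors, (p - 1) : ℕ), ?_⟩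
  refine mul_right_cancel₀ (Nat.cast_ne_zero.2 hm : (m : ℤ) ≠ 0) ?_
  linear_combination ((radical m : ℕ) : ℤ) * h + b * k * euler

theorem squarefree_of_div_eq_card_mulAut_div_card {G : Type*} [CommGroup G] [Finite G] {a b : ℤ}
    (hb : b ≠ 0) (hab : IsCoprime a b)
    (h : (a : ℚ) / b = (Nat.card (MulAut G) : ℚ) / Nat.card G) : Squarefree b := by
  obtain ⟨g, hg⟩ := Monoid.exists_orderOf_eq_exponent (Monoid.ExponentExists.of_finite (G := G))
  set C := Subgroup.zpowers g
  have hC : Nat.card C = Monoid.exponent G := (Nat.card_zpowers g).trans hg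
  obtain ⟨k, hk⟩ := card_quotient_mul_totient_dvd_card_mulAut C hC
  have hm : Nat.card C ≠ 0 := Nat.card_pos.ne'
  have hq : Nat.card (G ⧸ C) ≠ 0 := Nat.card_pos.ne'
  have key : a * (Nat.card C : ℤ) = b * (k * Nat.totient (Nat.card C)) := by
    rw [hk, C.card_eq_card_quotient_mul_card_subgroup] at h
    push_cast at h
    have hb' : (b : ℚ) ≠ 0 := Int.cast_ne_zero.2 hb
    have hm' : (Nat.card C : ℚ) ≠ 0 := Nat.cast_ne_zero.2 hm
    have hq' : (Nat.card (G ⧸ C) : ℚ) ≠ 0 := Nat.cast_ne_zero.2 hq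
    field_simp at h
    have h' : (a : ℚ) * Nat.card C = b * (k * Nat.totient (Nat.card C)) := by
      linear_combination h
    exact_mod_cast h'
  exact (Int.squarefree_natCast.2 UniqueFactorizationMonoid.squarefree_radical).squarefree_of_dvd
    (dvd_radical_of_mul_eq_mul_totient hm hab key)

end Denominator

theorem theorem1 :
    (∀ (G : Type u) [CommGroup G] [Finite G] (a b : ℤ), b ≠ 0 → IsCoprime a b →
      (a : ℚ) / (b : ℚ) = (Nat.card (MulAut G) : ℚ) / (Nat.card G : ℚ) → Squarefree b) ∧
    ¬ (∀ r : ℚ, 0 < r → ∃ (G : Type u) (_ : CommGroup G) (_ : Finite G),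
      (Nat.card (MulAut G) : ℚ) / (Nat.card G : ℚ) = r) := by
  refine ⟨fun G _ _ a b hb hab h ↦ squarefree_of_div_eq_card_mulAut_div_card hb hab h, fun H ↦ ?_⟩
  obtain ⟨G, _, _, h⟩ := H (1 / 4) (by norm_num)
  have h4 : Squarefree (4 : ℤ) := squarefree_of_div_eq_card_mulAut_div_card (G := G) (a := 1)
    (by norm_num) isCoprime_one_left (by rw [h]; norm_num)
  have : IsUnit (2 : ℤ) := h4 2 (by norm_num)
  exact absurd this (by decide)
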